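/- Let $N\ge 0$ be an integer, $\mathbb T^N=\mathbb R^N/\mathbb Z^N$ the flat torus, $\langle\cdot,\cdot\rangle$ and $|\cdot|$ the Euclidean scalar product and norm on $\mathbb R^N$, and $|x|=\min_{k\in\mathbb Z^N}|x+k|$ the induced norm on $\mathbb T^N$. A function $H:\mathbb T^N\times\mathbb R^N\to\mathbb R$ is a *Tonelli Hamiltonian* if it is of class $C^2$, $p\mapsto H(x,p)$ is strictly convex for every $x$, $\frac{\partial^2H}{\partial p^2}(x,p)$ is positive definite for every $(x,p)$, and there are functions $\alpha,\beta:[0,\infty)\to\mathbb R$ with $\alpha(h)/h\to+\infty$ and $\beta(h)/h\to+\infty$ as $h\to+\infty$ such that $\alpha(|p|)\le H(x,p)\le\beta(|p|)$ for all $(x,p)$. Its Lagrangian is $L_H(x,q)=\sup_{p\in\mathbb R^N}\{\langle p,q\rangle-H(x,p)\}$. A function $u:\mathbb T^N\to\mathbb R\cup\{+\infty\}$ is an *admissible initial datum* if $u\ge a|\cdot|+b$ on $\mathbb T^N$ for some $a,b\in\mathbb R$. For $t>0$ and such $u$, the Lax--Oleinik semigroup is $$(S_H(t)u)(x)=\inf\Big\{u(\gamma(-t))+\int_{-t}^0L_H(\gamma(s),\dot\gamma(s))\,ds\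 :\ \gamma:[-t,0]\to\mathbb T^N\text{ absolutely continuous},\ \gamma(0)=x\Big\}.$$ **Proposition.** Let $G$ and $H$ be two Tonelli Hamiltonians on $\mathbb T^N\times\mathbb R^N$. Assume that $$S_G(s)\big(S_H(t)u\big)(x)=S_H(t)\big(S_G(s)u\big)(x)\qquad\text{for every }s,t>0\text{ and }x\in\mathbb T^N,$$ and for every admissible initial datum $u:\mathbb T^N\to\mathbb R\cup\{+\infty\}$. Then $$\langle D_xG(x,p),D_pH(x,p)\rangle-\langle D_xH(x,p),D_pG(x,p)\rangle=0\qquad\text{for all }(x,p)\in\mathbb T^N\times\mathbb R^N.$$ -/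

import Mathlib

open MeasureTheory Set Filter Topology

noncomputable section

namespace HamiltonJacobi

/-- Euclidean space `ℝ^N`. -/
abbrev Euc (N : ℕ) : Type := EuclideanSpace ℝ (Fin N)

/-- The flat torus `𝕋^N = ℝ^N / ℤ^N`. -/
abbrev Torus (N : ℕ) : Type := UnitAddTorus (Fin N)

/-- The canonical projection `ℝ^N → 𝕋^N`. -/
def proj {N : ℕ} (y : Euc N) : Torus N := fun i => (y i : UnitAddCircle)

/-- The norm on the torus induced by the Euclidean norm: `|x| = min {|y| : y ∈ ℝ^N a lift of x}`. -/
def torusNorm {N : ℕ} (x : Torus N) : ℝ := sInf {r : ℝ | ∃ y : Euc N, proj y = x ∧ r = ‖y‖}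

/-- A function `g : [0,∞) → ℝ` is superlinear if `g h / h → +∞` as `h → +∞`.
(Values of `g` at negative numbers play no role.) -/
def Superlinear (g : ℝ → ℝ) : Prop := Tendsto (fun h => g h / h) atTop atTop

/-- Tonelli Hamiltonians on `𝕋^N × ℝ^N`. -/
structure IsTonelli {N : ℕ} (H : Torus N → Euc N → ℝ) : Prop where
  /-- `H` is continuous. -/
  continuous : Continuous fun z : Torus N × Euc N => H z.1 z.2
  /-- `H` is strictly convex in the momentum. -/
  strictConvex : ∀ x, StrictConvexOn ℝ univ (H x)
  /-- `H` lies between two superlinear functions of `|p|`. -/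
  superlinear : ∃ α β : ℝ → ℝ, Superlinear α ∧ Superlinear β ∧
    ∀ x p, α ‖p‖ ≤ H x p ∧ H x p ≤ β ‖p‖
  /-- `H` is of class `C²` on `𝕋^N × ℝ^N`, that is, its lift to `ℝ^N × ℝ^N` is. -/
  contDiff : ContDiff ℝ 2 fun z : Euc N × Euc N => H (proj z.1) z.2
  /-- The second derivative of `H` in the momentum is positive definite everywhere. -/
  posDef : ∀ x p v, v ≠ 0 → 0 < fderiv ℝ (fderiv ℝ (H x)) p v v

/-- The Lagrangian `L(x,q) = sup_p (⟨p,q⟩ - H(x,p))`. -/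
def lagrangian {N : ℕ} (H : Torus N → Euc N → ℝ) (x : Torus N) (q : Euc N) : ℝ :=
  ⨆ p : Euc N, (inner ℝ p q - H x p)

open Classical in
/-- The action `∫_{-t}^0 L(γ, γ') ds ∈ ℝ ∪ {+∞}` of the curve in the torus whose lift to `ℝ^N`
is `γ`. For absolutely continuous `γ` and Tonelli `H` the integrand is measurable and bounded
below, so the integral is `+∞` exactly when the integrand is not integrable. -/
def action {N : ℕ} (H : Torus N → Euc N → ℝ) (t : ℝ) (γ : ℝ → Euc N) : EReal :=
  if IntervalIntegrable (fun s => lagrangian H (proj (γ s)) (deriv γ s)) volume (-t) 0 then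
    ((∫ s in (-t)..0, lagrangian H (proj (γ s)) (deriv γ s) : ℝ) : EReal)
  else ⊤

/-- The Lax--Oleinik semigroup
`(S_H(t) u)(x) = inf { u(γ(-t)) + ∫_{-t}^0 L(γ, γ') ds : γ ∈ W^{1,1}([-t,0]; 𝕋^N), γ(0) = x }`.
The absolutely continuous curves in the torus are exactly the projections of the absolutely
continuous curves in `ℝ^N`, and the velocity of a curve is the derivative of any of its lifts. -/
def laxOleinik {N : ℕ} (H : Torus N → Euc N → ℝ) (t : ℝ) (u : Torus N → EReal) (x : Torus N) :
    EReal :=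
  ⨅ (γ : ℝ → Euc N) (_ : AbsolutelyContinuousOnInterval γ (-t) 0) (_ : proj (γ 0) = x),
    u (proj (γ (-t))) + action H t γ

/-- Admissible initial data: functions `u : 𝕋^N → ℝ ∪ {+∞}` with `u ≥ a |·| + b` for some real
`a`, `b`. -/
def IsAdmissible {N : ℕ} (u : Torus N → EReal) : Prop :=
  ∃ a b : ℝ, ∀ x, ((a * torusNorm x + b : ℝ) : EReal) ≤ u x

/-- The partial gradient `D_x H(x,p)`, with a neighbourhood of `x` in the torus parametrized by
`v ↦ x + v`. -/
def gradX {N : ℕ} (H : Torus N → Euc N → ℝ) (x : Torus N) (p : Euc N) : Euc N :=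
  gradient (fun v : Euc N => H (x + proj v) p) 0

/-- The partial gradient `D_p H(x,p)`. -/
def gradP {N : ℕ} (H : Torus N → Euc N → ℝ) (x : Torus N) (p : Euc N) : Euc N :=
  gradient (H x) p

end HamiltonJacobi

end

noncomputable section

namespace HamiltonJacobi

variable {N : ℕ}

/-! Fix a lift `x` and a momentum `p`, and let the datum be affine with slope `p` near `x` and `+∞`
elsewhere. The order in which the two semigroups act for a short time `ε` shows up in their value at
`x` only at second order: up to `o(ε²)`, applying `H` and then `G` gives a part symmetric in `G, H`
plus `ε² ⟨D_xH, D_pG⟩`, while the opposite order gives the same part plus `ε² ⟨D_xG, D_pH⟩`. Only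
one bound is needed for each order. `exists_le_laxOleinik_laxOleinik` bounds the first value from
below: the Fenchel inequality is tested with a momentum that follows `p' = -D_x` to first order,
continuously across the two stages. `exists_laxOleinik_laxOleinik_le` bounds the second value from
above, by test curves with velocity `D_p(·, p)`, on which Fenchel is an equality. Commutation,
division by `ε²` and `η → 0` give `⟨D_xH, D_pG⟩ ≤ ⟨D_xG, D_pH⟩`. Exchanging `G` and `H` gives the
reverse inequality. -/

/-! ### The covering of the torus by `ℝ^N`. -/

lemma proj_add (y z : Euc N) : proj (y + z) = proj y + proj z := by
  ext i; simp [proj]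

lemma proj_sub (y z : Euc N) : proj (y - z) = proj y - proj z := by
  ext i; simp [proj]

lemma continuous_proj : Continuous (proj : Euc N → Torus N) := by
  refine continuous_pi fun i => ?_
  exact (AddCircle.continuous_mk' 1).comp (by fun_prop)

lemma proj_surjective : Function.Surjective (proj : Euc N → Torus N) := by
  intro x
  choose f hf using fun i => QuotientAddGroup.mk_surjective (x i)
  exact ⟨WithLp.toLp 2 f, funext hf⟩

/-- Two lifts differ by an integer vector. This later excludes short curves that end at another lift
of the base point. -/
lemma eq_or_one_le_norm_sub_of_proj_eq {y z : Euc N} (h : proj y = proj z) :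
    y = z ∨ 1 ≤ ‖y - z‖ := by
  rw [or_iff_not_imp_left]
  intro hne
  obtain ⟨i, hi⟩ : ∃ i, y i ≠ z i := by
    by_contra! hall
    exact hne (by ext i; exact hall i)
  have hc : ((y i - z i : ℝ) : UnitAddCircle) = 0 := by
    have := congrFun h i
    simp only [proj] at this
    rw [AddCircle.coe_sub, this, sub_self]
  obtain ⟨n, hn⟩ := (AddCircle.coe_eq_zero_iff 1).1 hc
  have hn0 : n ≠ 0 := by
    rintro rfl
    exact hi (sub_eq_zero.1 (by simpa using hn.symm))
  have h1 : (1 : ℝ) ≤ |(n : ℝ)| := by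
    exact_mod_cast Int.one_le_abs hn0
  calc (1 : ℝ) ≤ |(n : ℝ)| := h1
    _ = ‖(y - z) i‖ := by rw [PiLp.sub_apply, ← hn]; simp
    _ ≤ ‖y - z‖ := PiLp.norm_apply_le _ _

/-! ### Convexity, duality and Taylor expansion for a Tonelli Hamiltonian. -/

namespace IsTonelli

variable {H : Torus N → Euc N → ℝ} (hH : IsTonelli H)
include hH

lemma exists_le_of_norm_le (A : ℝ) : ∃ C : ℝ, 0 ≤ C ∧ ∀ x p, ‖p‖ ≤ A → |H x p| ≤ C := by
  obtain ⟨C, hC⟩ := ((isCompact_univ (X := Torus N)).prod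
    (isCompact_closedBall (0 : Euc N) A)).exists_bound_of_continuousOn hH.continuous.continuousOn
  refine ⟨max C 0, le_max_right _ _, fun x p hp => le_max_of_le_left ?_⟩
  exact hC (x, p) ⟨mem_univ _, by simpa using hp⟩

/-- By superlinearity `H x p ≥ ‖q‖ ‖p‖` for large `p`, and compactness handles the remaining ball.
Without this bound the real supremum defining `lagrangian` would take its default value. -/
lemma bddAbove (x : Torus N) (q : Euc N) :
    BddAbove (range fun p : Euc N => inner ℝ p q - H x p) := by
  obtain ⟨α, β, hα, -, hαβ⟩ := hH.superlinear
  obtain ⟨R, hR⟩ := eventually_atTop.1 (hα.eventually_ge_atTop ‖q‖)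
  obtain ⟨C, hC0, hC⟩ := hH.exists_le_of_norm_le (max R 1)
  refine ⟨max R 1 * ‖q‖ + C, ?_⟩
  rintro _ ⟨p, rfl⟩
  have hin : inner ℝ p q ≤ ‖p‖ * ‖q‖ := real_inner_le_norm p q
  rcases le_total ‖p‖ (max R 1) with h | h
  · have h1 := (abs_le.1 (hC x p h)).1
    have h2 : ‖p‖ * ‖q‖ ≤ max R 1 * ‖q‖ := by gcongr
    dsimp only
    linarith
  · have hp : 0 < ‖p‖ := by linarith [le_max_right R 1]
    have h1 := hR ‖p‖ ((le_max_left _ _).trans h)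
    rw [le_div_iff₀ hp] at h1
    have h2 := (hαβ x p).1
    have h3 : 0 ≤ max R 1 * ‖q‖ := by positivity
    dsimp only
    linarith

lemma le_lagrangian (x : Torus N) (p q : Euc N) : inner ℝ p q - H x p ≤ lagrangian H x q :=
  le_ciSup (hH.bddAbove x q) p

lemma differentiable_lift :
    Differentiable ℝ fun z : Euc N × Euc N => H (proj z.1) z.2 :=
  hH.contDiff.differentiable (by norm_num)

lemma hasFDerivAt_right (y p : Euc N) :
    HasFDerivAt (H (proj y)) ((fderiv ℝ (fun z : Euc N × Euc N => H (proj z.1) z.2) (y, p)).comp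
      (ContinuousLinearMap.inr ℝ (Euc N) (Euc N))) p := by
  have h1 := (hH.differentiable_lift (y, p)).hasFDerivAt
  exact h1.comp p (hasFDerivAt_prodMk_right (𝕜 := ℝ) y p)

lemma inner_gradP (y p w : Euc N) : inner ℝ (gradP H (proj y) p) w =
    fderiv ℝ (fun z : Euc N × Euc N => H (proj z.1) z.2) (y, p) (0, w) := by
  rw [gradP, gradient, InnerProductSpace.toDual_symm_apply, (hH.hasFDerivAt_right y p).fderiv]
  simp

lemma inner_gradX (y p w : Euc N) : inner ℝ (gradX H (proj y) p) w =
    fderiv ℝ (fun z : Euc N × Euc N => H (proj z.1) z.2) (y, p) (w, 0) := by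
  have h1 := (hH.differentiable_lift (y + 0, p)).hasFDerivAt
  have h2 : HasFDerivAt (fun v : Euc N => (y + v, p))
      (ContinuousLinearMap.inl ℝ (Euc N) (Euc N)) 0 :=
    ((hasFDerivAt_id (0 : Euc N)).const_add y).prodMk (hasFDerivAt_const p 0)
  have h3 := HasFDerivAt.comp (0 : Euc N) h1 h2
  have h4 : (fun v : Euc N => H (proj y + proj v) p) =
      (fun z : Euc N × Euc N => H (proj z.1) z.2) ∘ fun v : Euc N => (y + v, p) := by
    ext v; simp [proj_add]
  rw [gradX, gradient, InnerProductSpace.toDual_symm_apply, h4, h3.fderiv]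
  simp

lemma hasGradientAt_right (y p : Euc N) : HasGradientAt (H (proj y)) (gradP H (proj y) p) p :=
  (hH.hasFDerivAt_right y p).differentiableAt.hasGradientAt

/-- First order Taylor expansion in both variables. -/
lemma exists_taylor (y p : Euc N) {η : ℝ} (hη : 0 < η) : ∃ δ > 0, ∀ z q : Euc N,
    ‖z - y‖ ≤ δ → ‖q - p‖ ≤ δ →
    |H (proj z) q - H (proj y) p - inner ℝ (gradX H (proj y) p) (z - y)
      - inner ℝ (gradP H (proj y) p) (q - p)| ≤ η * (‖z - y‖ + ‖q - p‖) := by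
  have h1 := (hH.differentiable_lift (y, p)).hasFDerivAt
  have h2 := (hasFDerivAt_iff_isLittleO.1 h1).def hη
  obtain ⟨δ, hδ, h3⟩ := Metric.eventually_nhds_iff_ball.1 h2
  refine ⟨δ / 2, by positivity, fun z q hz hq => ?_⟩
  have h4 := h3 (z, q) (by
    rw [mem_ball_iff_norm, Prod.mk_sub_mk, Prod.norm_def]
    exact max_lt (by dsimp only; linarith) (by dsimp only; linarith))
  rw [Real.norm_eq_abs, Prod.mk_sub_mk] at h4
  have h5 : (z - y, q - p) = ((z - y, 0) : Euc N × Euc N) + (0, q - p) := by simp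
  rw [h5, map_add, ← h5, ← hH.inner_gradX, ← hH.inner_gradP, ← sub_sub] at h4
  refine h4.trans ?_
  gcongr
  rw [Prod.norm_def]
  exact max_le (by simp) (by simp)

/-- The supporting hyperplane inequality for the convex function `H (proj y)`. -/
lemma add_inner_gradP_le (y p q : Euc N) :
    H (proj y) p + inner ℝ (gradP H (proj y) p) (q - p) ≤ H (proj y) q := by
  have hc := (hH.strictConvex (proj y)).convexOn
  have hline : ConvexOn ℝ univ fun t : ℝ => H (proj y) (AffineMap.lineMap p q t) := by
    have := hc.comp_affineMap (AffineMap.lineMap p q : ℝ →ᵃ[ℝ] Euc N)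
    exact this
  have hd : HasDerivAt (fun t : ℝ => H (proj y) (AffineMap.lineMap p q t))
      (inner ℝ (gradP H (proj y) p) (q - p)) 0 := by
    have h1 : HasFDerivAt (H (proj y)) (InnerProductSpace.toDual ℝ (Euc N) (gradP H (proj y) p))
        (AffineMap.lineMap p q (0 : ℝ)) := by
      rw [AffineMap.lineMap_apply_zero]
      exact (hH.hasGradientAt_right y p).hasFDerivAt
    have h2 := h1.comp_hasDerivAt (0 : ℝ) (AffineMap.hasDerivAt_lineMap (a := p) (b := q))
    simp only [InnerProductSpace.toDual_apply_apply] at h2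
    exact h2
  have := hline.le_slope_of_hasDerivAt (mem_univ 0) (mem_univ 1) one_pos hd
  rw [slope_def_field] at this
  simp at this
  linarith

/-- Equality in the Fenchel inequality. -/
lemma lagrangian_gradP (y p : Euc N) : lagrangian H (proj y) (gradP H (proj y) p) =
    inner ℝ p (gradP H (proj y) p) - H (proj y) p := by
  refine le_antisymm (ciSup_le fun q => ?_) (hH.le_lagrangian _ _ _)
  have := hH.add_inner_gradP_le y p q
  rw [inner_sub_right, real_inner_comm q, real_inner_comm p] at this
  linarith

/-- This regularity lets the field `D_p H(·, p)` be integrated by Picard–Lindelöf. -/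
lemma contDiff_gradP (p : Euc N) : ContDiff ℝ 1 fun y : Euc N => gradP H (proj y) p := by
  have h1 : ContDiff ℝ 1 (fderiv ℝ fun z : Euc N × Euc N => H (proj z.1) z.2) :=
    hH.contDiff.fderiv_right (by norm_num)
  have h2 : ContDiff ℝ 1 fun y : Euc N =>
      (fderiv ℝ (fun z : Euc N × Euc N => H (proj z.1) z.2) (y, p)).comp
      (ContinuousLinearMap.inr ℝ (Euc N) (Euc N)) :=
    (h1.comp (by fun_prop : ContDiff ℝ 1 fun y : Euc N => (y, p))).clm_comp contDiff_const
  have h3 : (fun y : Euc N => gradP H (proj y) p) = fun y : Euc N =>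
      (InnerProductSpace.toDual ℝ (Euc N)).symm
      ((fderiv ℝ (fun z : Euc N × Euc N => H (proj z.1) z.2) (y, p)).comp
      (ContinuousLinearMap.inr ℝ (Euc N) (Euc N))) := by
    ext1 y
    rw [gradP, gradient, (hH.hasFDerivAt_right y p).fderiv]
  rw [h3]
  exact (InnerProductSpace.toDual ℝ (Euc N)).symm.toContinuousLinearEquiv.contDiff.comp h2

end IsTonelli

/-! ### Absolutely continuous curves. -/

lemma AbsolutelyContinuousOnInterval.inner_left {γ : ℝ → Euc N} {a b : ℝ}
    (hγ : AbsolutelyContinuousOnInterval γ a b) (v : Euc N) :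
    AbsolutelyContinuousOnInterval (fun s => inner ℝ v (γ s)) a b := by
  refine squeeze_zero (fun E => Finset.sum_nonneg fun i _ => dist_nonneg) (fun E => ?_)
    (by simpa using Tendsto.const_mul ‖v‖ hγ)
  rw [Finset.mul_sum]
  refine Finset.sum_le_sum fun i _ => ?_
  rw [dist_eq_norm, dist_eq_norm, ← inner_sub_right]
  exact norm_inner_le_norm _ _

/-- The calibration argument behind every action estimate below: a pointwise Fenchel inequality is
integrated, and `deriv W` contributes only boundary terms. -/
lemma sub_add_integral_le_of_deriv_add_le {W f c : ℝ → ℝ} {a b : ℝ} (hab : a ≤ b)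
    (hW : AbsolutelyContinuousOnInterval W a b) (hf : IntervalIntegrable f volume a b)
    (hc : Continuous c) (h : ∀ᵐ s, s ∈ Icc a b → deriv W s + c s ≤ f s) :
    W b - W a + ∫ s in a..b, c s ≤ ∫ s in a..b, f s := by
  have hd := hW.intervalIntegrable_deriv
  have hci := hc.intervalIntegrable (μ := volume) a b
  rw [← hW.integral_deriv_eq_sub, ← intervalIntegral.integral_add hd hci]
  exact intervalIntegral.integral_mono_ae_restrict hab (hd.add hci) hf
    ((ae_restrict_iff' measurableSet_Icc).2 h)

lemma ae_differentiableAt_of_absolutelyContinuous {γ : ℝ → Euc N} {a b : ℝ} (hab : a ≤ b)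
    (hγ : AbsolutelyContinuousOnInterval γ a b) :
    ∀ᵐ s, s ∈ Icc a b → DifferentiableAt ℝ γ s := by
  have := hγ.boundedVariationOn.ae_differentiableAt_of_mem_uIcc
  rwa [uIcc_of_le hab] at this

/-- The integrand of the action of the curve with lift `γ`. -/
abbrev lagrangianAlong (H : Torus N → Euc N → ℝ) (γ : ℝ → Euc N) (s : ℝ) : ℝ :=
  lagrangian H (proj (γ s)) (deriv γ s)

/-! ### Lower bounds for the action. -/

namespace IsTonelli

variable {H : Torus N → Euc N → ℝ} (hH : IsTonelli H)
include hH

/-- Fenchel with one constant momentum of norm at most `A` along the displacement. `C` bounds `|H|`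
on such momenta, so it does not depend on the curve. -/
lemma exists_coercive {A : ℝ} (hA : 0 ≤ A) : ∃ C : ℝ, 0 ≤ C ∧ ∀ (γ : ℝ → Euc N) (a b : ℝ), a ≤ b →
    AbsolutelyContinuousOnInterval γ a b →
    IntervalIntegrable (lagrangianAlong H γ) volume a b →
    A * ‖γ b - γ a‖ - C * (b - a) ≤ ∫ s in a..b, lagrangianAlong H γ s := by
  obtain ⟨C, hC0, hC⟩ := hH.exists_le_of_norm_le A
  refine ⟨C, hC0, fun γ a b hab hγ hf => ?_⟩
  set d := γ b - γ a with hd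
  -- For `d = 0` the division convention gives `e = 0`, which still works.
  set e := (A / ‖d‖) • d with he
  have hen : ‖e‖ ≤ A := by
    rw [he, norm_smul, norm_div, norm_norm, Real.norm_of_nonneg hA]
    rcases eq_or_ne ‖d‖ 0 with h0 | h0
    · simpa [h0] using hA
    · rw [div_mul_cancel₀ _ h0]
  have hed : inner ℝ e d = A * ‖d‖ := by
    rw [he, real_inner_smul_left, real_inner_self_eq_norm_sq]
    rcases eq_or_ne ‖d‖ 0 with h0 | h0
    · simp [h0]
    · field_simp
  have key := sub_add_integral_le_of_deriv_add_le hab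
    (AbsolutelyContinuousOnInterval.inner_left hγ e) hf (continuous_const (y := -C)) (by
      filter_upwards [ae_differentiableAt_of_absolutelyContinuous hab hγ] with s hs hsab
      have h1 : HasDerivAt (fun s => inner ℝ e (γ s)) (inner ℝ e (deriv γ s)) s := by
        simpa using (hasDerivAt_const s e).inner ℝ (hs hsab).hasDerivAt
      rw [h1.deriv]
      have h2 := (abs_le.1 (hC (proj (γ s)) e hen)).2
      have h3 := hH.le_lagrangian (proj (γ s)) e (deriv γ s)
      linarith)
  rw [← inner_sub_right, ← hd, hed, intervalIntegral.integral_const, smul_eq_mul] at key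
  linarith

/-- The intermediate time `c` serves to confine the whole curve, not only its endpoints. -/
lemma exists_coercive_split {A : ℝ} (hA : 0 ≤ A) : ∃ C : ℝ, 0 ≤ C ∧ ∀ (γ : ℝ → Euc N) (a b c : ℝ),
    a ≤ c → c ≤ b → AbsolutelyContinuousOnInterval γ a b →
    IntervalIntegrable (lagrangianAlong H γ) volume a b →
    A * (‖γ b - γ c‖ + ‖γ c - γ a‖) - C * (b - a) ≤ ∫ s in a..b, lagrangianAlong H γ s := by
  obtain ⟨C, hC0, hC⟩ := hH.exists_coercive hA
  refine ⟨C, hC0, fun γ a b c hac hcb hγ hf => ?_⟩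
  have s1 : uIcc a c ⊆ uIcc a b := by
    rw [uIcc_of_le hac, uIcc_of_le (hac.trans hcb)]; exact Icc_subset_Icc_right hcb
  have s2 : uIcc c b ⊆ uIcc a b := by
    rw [uIcc_of_le hcb, uIcc_of_le (hac.trans hcb)]; exact Icc_subset_Icc_left hac
  have h1 := hC γ a c hac (hγ.mono s1) (hf.mono_set s1)
  have h2 := hC γ c b hcb (hγ.mono s2) (hf.mono_set s2)
  rw [← intervalIntegral.integral_add_adjacent_intervals (hf.mono_set s1) (hf.mono_set s2)]
  linarith

/-- Lower bound for the action of a curve that stays close to `x`, obtained by testing the Fenchel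
inequality with the momentum `p - e - (s + t) D_x H`. -/
lemma le_integral_lagrangianAlong {x p e : Euc N} {η δ R t : ℝ} (ht : 0 ≤ t) (hη : 0 ≤ η)
    (hδ : ∀ z q : Euc N, ‖z - x‖ ≤ δ → ‖q - p‖ ≤ δ →
      |H (proj z) q - H (proj x) p - inner ℝ (gradX H (proj x) p) (z - x)
        - inner ℝ (gradP H (proj x) p) (q - p)| ≤ η * (‖z - x‖ + ‖q - p‖)) (hR : R ≤ δ)
    (heR : ‖e‖ + t * ‖gradX H (proj x) p‖ ≤ R) {γ : ℝ → Euc N}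
    (hγ : AbsolutelyContinuousOnInterval γ (-t) 0)
    (hf : IntervalIntegrable (lagrangianAlong H γ) volume (-t) 0)
    (hγR : ∀ s ∈ Icc (-t) 0, ‖γ s - x‖ ≤ R) :
    inner ℝ (p - e - t • gradX H (proj x) p) (γ 0 - x) - inner ℝ (p - e) (γ (-t) - x)
      - t * H (proj x) p + t * inner ℝ (gradP H (proj x) p) e
      + t ^ 2 / 2 * inner ℝ (gradX H (proj x) p) (gradP H (proj x) p) - 2 * η * R * t
      ≤ ∫ s in (-t)..0, lagrangianAlong H γ s := by
  set D := gradX H (proj x) p with hD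
  set V := gradP H (proj x) p with hV
  -- Since `P' = -D`, the term `⟨P', γ - x⟩` in the derivative of `⟨P, γ - x⟩` cancels the term `⟨D,
  -- γ - x⟩` in the expansion of `H (γ, P)`, so the remaining bound no longer depends on the curve.
  set P : ℝ → Euc N := fun s => p - e - (s + t) • D with hP
  have hγx : AbsolutelyContinuousOnInterval (fun s => γ s - x) (-t) 0 :=
    hγ.fun_sub (LipschitzOnWith.absolutelyContinuousOnInterval (K := 0)
      (LipschitzWith.const x).lipschitzOnWith)
  have hlin : AbsolutelyContinuousOnInterval (fun s : ℝ => s + t) (-t) 0 :=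
    ContDiffOn.absolutelyContinuousOnInterval (by fun_prop)
  have hWac : AbsolutelyContinuousOnInterval (fun s => inner ℝ (P s) (γ s - x)) (-t) 0 := by
    have h1 := (AbsolutelyContinuousOnInterval.inner_left hγx (p - e)).sub
      (hlin.mul (AbsolutelyContinuousOnInterval.inner_left hγx D))
    have h2 : (fun s => inner ℝ (P s) (γ s - x)) = (fun s => inner ℝ (p - e) (γ s - x)) -
        (fun s => s + t) * fun s => inner ℝ D (γ s - x) := by
      ext s
      simp only [hP, inner_sub_left (p - e), real_inner_smul_left, Pi.sub_apply, Pi.mul_apply]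
    rw [h2]
    exact h1
  have key := sub_add_integral_le_of_deriv_add_le (by linarith : -t ≤ 0) hWac hf
    (c := fun s => -H (proj x) p + inner ℝ V e - 2 * η * R + (s + t) * inner ℝ D V)
    (by fun_prop) (by
      filter_upwards [ae_differentiableAt_of_absolutelyContinuous (by linarith) hγ] with s hs hsab
      have hPd : HasDerivAt P (-D) s := by
        have := ((((hasDerivAt_id s).add_const t).smul_const D).const_sub (p - e))
        simpa using this
      have h1 := hPd.inner ℝ ((hs hsab).hasDerivAt.sub_const x)
      rw [h1.deriv]
      have hPp : P s - p = -(e + (s + t) • D) := by simp only [hP]; abel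
      have hPn : ‖P s - p‖ ≤ R := by
        rw [hPp, norm_neg]
        refine (norm_add_le _ _).trans (le_trans ?_ heR)
        rw [norm_smul, Real.norm_of_nonneg (by linarith [hsab.1])]
        gcongr
        linarith [hsab.2]
      have h2 := (abs_le.1 (hδ (γ s) (P s) ((hγR s hsab).trans hR) (hPn.trans hR))).2
      have h3 := hH.le_lagrangian (proj (γ s)) (P s) (deriv γ s)
      have h4 : η * (‖γ s - x‖ + ‖P s - p‖) ≤ η * (R + R) := by
        gcongr
        exact hγR s hsab
      rw [hPp, inner_neg_right, inner_add_right, real_inner_smul_right, real_inner_comm D V] at h2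
      rw [hPp] at h4
      rw [inner_neg_left]
      dsimp only [lagrangianAlong]
      linarith)
  have hint : ∫ s in (-t)..0, (-H (proj x) p + inner ℝ V e - 2 * η * R + (s + t) * inner ℝ D V)
      = t * (-H (proj x) p + inner ℝ V e - 2 * η * R) + t ^ 2 / 2 * inner ℝ D V := by
    rw [intervalIntegral.integral_add (by simp) (Continuous.intervalIntegrable (by fun_prop) _ _),
      intervalIntegral.integral_mul_const, intervalIntegral.integral_add (by simp) (by simp)]
    simp
    ring
  rw [hint] at key
  simp only [hP, zero_add, neg_add_cancel, zero_smul, sub_zero] at key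
  linarith

end IsTonelli

/-! ### The affine datum and reduction to matching lifts. -/

/-- The initial datum which is affine with slope `p` on a ball around the projection of `x`, and
`+∞` elsewhere. -/
def affineDatum (x p : Euc N) (y : Torus N) : EReal :=
  ⨅ (v : Euc N) (_ : ‖v‖ ≤ 1 / 2 ∧ proj (x + v) = y), ((inner ℝ p v : ℝ) : EReal)

lemma neg_norm_le_affineDatum (x p : Euc N) (y : Torus N) :
    ((-‖p‖ : ℝ) : EReal) ≤ affineDatum x p y := by
  refine le_iInf fun v => le_iInf fun hv => EReal.coe_le_coe_iff.2 ?_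
  have h1 := (abs_le.1 (abs_real_inner_le_norm p v)).1
  have h2 : ‖p‖ * ‖v‖ ≤ ‖p‖ * 1 := by gcongr; linarith [hv.1]
  linarith

lemma isAdmissible_affineDatum (x p : Euc N) : IsAdmissible (affineDatum x p) :=
  ⟨0, -‖p‖, fun y => by simpa using neg_norm_le_affineDatum x p y⟩

lemma action_eq_coe {H : Torus N → Euc N → ℝ} {t : ℝ} {γ : ℝ → Euc N}
    (h : IntervalIntegrable (lagrangianAlong H γ) volume (-t) 0) :
    action H t γ = ((∫ s in (-t)..0, lagrangianAlong H γ s : ℝ) : EReal) := if_pos h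

lemma action_eq_top {H : Torus N → Euc N → ℝ} {t : ℝ} {γ : ℝ → Euc N}
    (h : ¬ IntervalIntegrable (lagrangianAlong H γ) volume (-t) 0) : action H t γ = ⊤ := if_neg h

/-- The hypothesis `w ≠ ⊥` matters because `⊥ + ⊤ = ⊥` in `EReal`. -/
lemma le_add_action {H : Torus N → Euc N → ℝ} {t m : ℝ} {γ : ℝ → Euc N} {w : EReal}
    (hw : w ≠ ⊥) (h : IntervalIntegrable (lagrangianAlong H γ) volume (-t) 0 →
      ((m - ∫ s in (-t)..0, lagrangianAlong H γ s : ℝ) : EReal) ≤ w) :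
    (m : EReal) ≤ w + action H t γ := by
  by_cases hi : IntervalIntegrable (lagrangianAlong H γ) volume (-t) 0
  · rw [action_eq_coe hi]
    have := add_le_add_left (h hi) ((∫ s in (-t)..0, lagrangianAlong H γ s : ℝ) : EReal)
    rwa [← EReal.coe_add, sub_add_cancel] at this
  · rw [action_eq_top hi, EReal.add_top_of_ne_bot hw]
    exact le_top

lemma IsTonelli.laxOleinik_affineDatum_ne_bot {H : Torus N → Euc N → ℝ} (hH : IsTonelli H)
    {t : ℝ} (ht : 0 ≤ t) (x p : Euc N) (y : Torus N) :
    laxOleinik H t (affineDatum x p) y ≠ ⊥ := by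
  obtain ⟨C, -, hC⟩ := hH.exists_coercive le_rfl
  have hu : ∀ z, affineDatum x p z ≠ ⊥ := fun z hz => by
    have := neg_norm_le_affineDatum x p z
    rw [hz, le_bot_iff] at this
    exact EReal.coe_ne_bot _ this
  have : ((-‖p‖ - C * t : ℝ) : EReal) ≤ laxOleinik H t (affineDatum x p) y := by
    refine le_iInf fun γ => le_iInf fun hγ => le_iInf fun _ =>
      le_add_action (hu _) fun hi => le_trans ?_ (neg_norm_le_affineDatum x p _)
    rw [EReal.coe_le_coe_iff]
    have := hC γ (-t) 0 (by linarith) hγ hi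
    linarith
  intro h
  rw [h, le_bot_iff] at this
  exact EReal.coe_ne_bot _ this

lemma lagrangianAlong_add_const (H : Torus N → Euc N → ℝ) (γ : ℝ → Euc N) {k : Euc N}
    (hk : proj k = 0) : lagrangianAlong H (fun s => γ s + k) = lagrangianAlong H γ := by
  ext s
  simp only [lagrangianAlong, proj_add, hk, add_zero, deriv_add_const]

lemma absolutelyContinuousOnInterval_add_const {γ : ℝ → Euc N} {a b : ℝ}
    (hγ : AbsolutelyContinuousOnInterval γ a b) (k : Euc N) :
    AbsolutelyContinuousOnInterval (fun s => γ s + k) a b :=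
  hγ.fun_add (LipschitzOnWith.absolutelyContinuousOnInterval (K := 0)
      (LipschitzWith.const k).lipschitzOnWith)

/-- To bound the two-step value from below it suffices to consider pairs of lifts of curves that
match up in the universal cover. -/
lemma IsTonelli.le_laxOleinik_laxOleinik {G H : Torus N → Euc N → ℝ} (hH : IsTonelli H)
    {s t m : ℝ} (ht : 0 ≤ t) (x p : Euc N) (y : Torus N)
    (h : ∀ (v : Euc N) (γ₂ γ₁ : ℝ → Euc N), ‖v‖ ≤ 1 / 2 →
      AbsolutelyContinuousOnInterval γ₂ (-t) 0 → AbsolutelyContinuousOnInterval γ₁ (-s) 0 →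
      γ₂ (-t) = x + v → γ₁ (-s) = γ₂ 0 → proj (γ₁ 0) = y →
      IntervalIntegrable (lagrangianAlong H γ₂) volume (-t) 0 →
      IntervalIntegrable (lagrangianAlong G γ₁) volume (-s) 0 →
      m ≤ inner ℝ p v + (∫ r in (-t)..0, lagrangianAlong H γ₂ r)
        + ∫ r in (-s)..0, lagrangianAlong G γ₁ r) :
    (m : EReal) ≤ laxOleinik G s (laxOleinik H t (affineDatum x p)) y := by
  refine le_iInf fun γ₁ => le_iInf fun hγ₁ => le_iInf fun hy =>
    le_add_action (hH.laxOleinik_affineDatum_ne_bot ht x p _) fun hi₁ =>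
    le_iInf fun γ₂ => le_iInf fun hγ₂ => le_iInf fun h21 => le_add_action ?_ fun hi₂ =>
    le_iInf fun v => le_iInf fun hv => EReal.coe_le_coe_iff.2 ?_
  · intro hz
    have := neg_norm_le_affineDatum x p (proj (γ₂ (-t)))
    rw [hz, le_bot_iff] at this
    exact EReal.coe_ne_bot _ this
  -- Integer translations: `k₂` makes the first curve start at `x + v`, and `k₁` makes the second
  -- start where the first ends.
  set k₂ := x + v - γ₂ (-t) with hk₂
  have hk₂0 : proj k₂ = 0 := by rw [hk₂, proj_sub, hv.2, sub_self]
  set k₁ := γ₂ 0 + k₂ - γ₁ (-s) with hk₁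
  have hk₁0 : proj k₁ = 0 := by rw [hk₁, proj_sub, proj_add, hk₂0, add_zero, h21, sub_self]
  have := h v (fun s => γ₂ s + k₂) (fun s => γ₁ s + k₁) hv.1
    (absolutelyContinuousOnInterval_add_const hγ₂ k₂)
    (absolutelyContinuousOnInterval_add_const hγ₁ k₁) (by simp [hk₂]) (by simp [hk₁])
    (by rw [proj_add, hk₁0, add_zero, hy])
    (by rwa [lagrangianAlong_add_const H γ₂ hk₂0]) (by rwa [lagrangianAlong_add_const G γ₁ hk₁0])
  rw [lagrangianAlong_add_const H γ₂ hk₂0, lagrangianAlong_add_const G γ₁ hk₁0] at this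
  linarith

/-- Second order lower bound for `S_G(ε) S_H(ε) u` at `x`, for the affine datum `u`. -/
theorem exists_le_laxOleinik_laxOleinik {G H : Torus N → Euc N → ℝ} (hG : IsTonelli G)
    (hH : IsTonelli H) (x p : Euc N) : ∃ K : ℝ, ∀ η > 0, ∃ ε₀ > 0, ∀ ε, 0 < ε → ε ≤ ε₀ →
    ((-ε * (H (proj x) p + G (proj x) p)
      + ε ^ 2 / 2 * (inner ℝ (gradX H (proj x) p) (gradP H (proj x) p)
        + inner ℝ (gradX G (proj x) p) (gradP G (proj x) p))
      + ε ^ 2 * inner ℝ (gradX H (proj x) p) (gradP G (proj x) p) - K * η * ε ^ 2 : ℝ) : EReal)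
      ≤ laxOleinik G ε (laxOleinik H ε (affineDatum x p)) (proj x) := by
  obtain ⟨C₁, hC₁0, hC₁⟩ := hH.exists_coercive_split (by positivity : 0 ≤ ‖p‖ + 1)
  obtain ⟨C₂, hC₂0, hC₂⟩ := hG.exists_coercive_split (by positivity : 0 ≤ ‖p‖ + 1)
  set DH := gradX H (proj x) p with hDH
  set DG := gradX G (proj x) p with hDG
  set VH := gradP H (proj x) p with hVH
  set VG := gradP G (proj x) p with hVG
  -- For `ε ≤ 1`, `M * ε` exceeds the claimed bound, so only curves of total cost below `M * ε`
  -- matter.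
  set M := |H (proj x) p + G (proj x) p| + |inner ℝ DH VH + inner ℝ DG VG| + |inner ℝ DH VG|
    with hM
  have hM0 : 0 ≤ M := by positivity
  -- `κ * ε` bounds both the distance of such curves from `x` and the drift of the test momentum
  -- from `p`. Each stage then has error `2 * η * (κ * ε) * ε`, whence `K = 4 * κ`.
  set κ := M + C₁ + C₂ + ‖DH‖ + ‖DG‖ + 1 with hκ
  have hκ0 : 0 < κ := by positivity
  refine ⟨4 * κ, fun η hη => ?_⟩
  obtain ⟨δ₁, hδ₁0, hδ₁⟩ := hH.exists_taylor x p hη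
  obtain ⟨δ₂, hδ₂0, hδ₂⟩ := hG.exists_taylor x p hη
  refine ⟨min 1 (min (1 / 2 / κ) (min (δ₁ / κ) (δ₂ / κ))), by positivity, fun ε hε0 hε => ?_⟩
  simp only [le_min_iff, le_div_iff₀ hκ0] at hε
  obtain ⟨hε1, hε2, hε3, hε4⟩ := hε
  rw [mul_comm] at hε2 hε3 hε4
  refine hH.le_laxOleinik_laxOleinik hε0.le x p _ fun v γ₂ γ₁ hv hγ₂ hγ₁ h2 h12 h1 hi₂ hi₁ => ?_
  set I₂ := ∫ r in (-ε)..0, lagrangianAlong H γ₂ r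
  set I₁ := ∫ r in (-ε)..0, lagrangianAlong G γ₁ r
  rcases le_or_gt (M * ε) (inner ℝ p v + I₂ + I₁) with hbig | hsmall
  · refine le_trans ?_ hbig
    have hsq : ε ^ 2 ≤ ε := by nlinarith
    have e1 : -ε * (H (proj x) p + G (proj x) p) ≤ ε * |H (proj x) p + G (proj x) p| := by
      nlinarith [neg_abs_le (H (proj x) p + G (proj x) p)]
    have e2 : ε ^ 2 / 2 * (inner ℝ DH VH + inner ℝ DG VG) ≤
        ε * |inner ℝ DH VH + inner ℝ DG VG| := by
      refine (mul_le_mul_of_nonneg_left (le_abs_self _) (by positivity)).trans ?_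
      gcongr
      linarith
    have e3 : ε ^ 2 * inner ℝ DH VG ≤ ε * |inner ℝ DH VG| := by
      refine (mul_le_mul_of_nonneg_left (le_abs_self _) (by positivity)).trans ?_
      gcongr
    have e4 : 0 ≤ 4 * κ * η * ε ^ 2 := by positivity
    rw [hM]
    linarith
  -- Coercivity with slope `‖p‖ + 1` absorbs the possible gain `‖p‖ ‖v‖` of the datum and leaves one
  -- copy of `l₂ + l₁`.
  · have hlen : ∀ s₂ ∈ Icc (-ε) 0, ∀ s₁ ∈ Icc (-ε) 0, γ₁ 0 = x ∧
        ‖γ₂ 0 - γ₂ s₂‖ + ‖γ₂ s₂ - γ₂ (-ε)‖ + (‖γ₁ 0 - γ₁ s₁‖ + ‖γ₁ s₁ - γ₁ (-ε)‖)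
          ≤ (M + C₁ + C₂) * ε := by
      intro s₂ hs₂ s₁ hs₁
      have a1 := hC₁ γ₂ (-ε) 0 s₂ hs₂.1 hs₂.2 hγ₂ hi₂
      have a2 := hC₂ γ₁ (-ε) 0 s₁ hs₁.1 hs₁.2 hγ₁ hi₁
      set l₂ := ‖γ₂ 0 - γ₂ s₂‖ + ‖γ₂ s₂ - γ₂ (-ε)‖ with hl₂
      set l₁ := ‖γ₁ 0 - γ₁ s₁‖ + ‖γ₁ s₁ - γ₁ (-ε)‖ with hl₁
      have a3 : -(‖p‖ * ‖v‖) ≤ inner ℝ p v := (abs_le.1 (abs_real_inner_le_norm p v)).1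
      have a4 : ‖γ₁ 0 - (x + v)‖ ≤ l₂ + l₁ := by
        have b1 : ‖γ₂ 0 - γ₂ (-ε)‖ ≤ l₂ := norm_sub_le_norm_sub_add_norm_sub _ _ _
        have b2 : ‖γ₁ 0 - γ₁ (-ε)‖ ≤ l₁ := norm_sub_le_norm_sub_add_norm_sub _ _ _
        have b3 : γ₁ 0 - (x + v) = (γ₁ 0 - γ₁ (-ε)) + (γ₂ 0 - γ₂ (-ε)) := by
          rw [h12, h2]; abel
        rw [b3]
        exact (norm_add_le _ _).trans (by linarith)
      have a5 : ‖v‖ ≤ l₂ + l₁ → l₂ + l₁ ≤ (M + C₁ + C₂) * ε := by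
        intro hvl
        have b1 : ‖p‖ * ‖v‖ ≤ ‖p‖ * (l₂ + l₁) := by gcongr
        linarith
      have hle : (M + C₁ + C₂) * ε < 1 / 2 := by
        refine lt_of_lt_of_le ?_ hε2
        gcongr
        rw [hκ]
        linarith [norm_nonneg DH, norm_nonneg DG]
      rcases eq_or_one_le_norm_sub_of_proj_eq h1 with hx | hx
      · refine ⟨hx, a5 ?_⟩
        rw [hx] at a4
        simpa using a4
      -- Ending at another lift requires a displacement of at least `1 - ‖v‖ ≥ 1 / 2`, more than the
      -- length bound allows.
      · exfalso
        have b1 : ‖γ₁ 0 - x‖ ≤ ‖γ₁ 0 - (x + v)‖ + ‖v‖ := by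
          have : γ₁ 0 - x = (γ₁ 0 - (x + v)) + v := by abel
          rw [this]
          exact norm_add_le _ _
        have b2 := a5 (by linarith)
        linarith
    have hmem : (0 : ℝ) ∈ Icc (-ε) 0 := ⟨by linarith, le_rfl⟩
    obtain ⟨hx, -⟩ := hlen 0 hmem 0 hmem
    have hκε : (M + C₁ + C₂) * ε ≤ κ * ε := by
      gcongr
      rw [hκ]
      linarith [norm_nonneg DH, norm_nonneg DG]
    have hγ₁R : ∀ s ∈ Icc (-ε) 0, ‖γ₁ s - x‖ ≤ κ * ε := by
      intro s hs
      have := (hlen 0 hmem s hs).2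
      rw [hx, norm_sub_rev x] at this
      linarith [norm_nonneg (γ₂ 0 - γ₂ 0), norm_nonneg (γ₂ 0 - γ₂ (-ε)),
        norm_nonneg (γ₁ s - γ₁ (-ε))]
    have hγ₂R : ∀ s ∈ Icc (-ε) 0, ‖γ₂ s - x‖ ≤ κ * ε := by
      intro s hs
      have := (hlen s hs 0 hmem).2
      rw [hx, h12, norm_sub_rev x] at this
      have b1 : ‖γ₂ s - x‖ ≤ ‖γ₂ s - γ₂ 0‖ + ‖γ₂ 0 - x‖ := norm_sub_le_norm_sub_add_norm_sub _ _ _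
      rw [norm_sub_rev (γ₂ s) (γ₂ 0), norm_sub_rev (γ₂ 0) x] at b1
      linarith [norm_nonneg (x - x), norm_nonneg (γ₂ s - γ₂ (-ε))]
    have hDε : ε * ‖DH‖ + ε * ‖DG‖ ≤ κ * ε := by
      rw [hκ]
      nlinarith
    have k2 := hH.le_integral_lagrangianAlong (e := 0) hε0.le hη.le hδ₁ hε3
      (by rw [norm_zero, zero_add]; linarith [mul_nonneg hε0.le (norm_nonneg DG)]) hγ₂ hi₂ hγ₂R
    -- The `H` stage ends with momentum `p - ε • DH`. Starting the `G` stage there makes the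
    -- boundary terms at `γ₂ 0` cancel, and this shift produces the cross term `ε ^ 2 * ⟨DH, VG⟩`.
    have k1 := hG.le_integral_lagrangianAlong (e := ε • DH) hε0.le hη.le hδ₂ hε4
      (by rw [norm_smul, Real.norm_of_nonneg hε0.le]; exact hDε) hγ₁ hi₁ hγ₁R
    rw [← hDH, ← hVH, h2, sub_zero, inner_zero_right, add_sub_cancel_left] at k2
    rw [← hDG, ← hVG, hx, sub_self, inner_zero_right, h12, real_inner_smul_right,
      real_inner_comm DH VG] at k1
    linarith

/-! ### Upper bound by explicit test curves. -/

/-- Integral curves of a `C¹` vector field starting near `x` keep their velocity close to `f x`,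
uniformly in the starting point. -/
lemma exists_integralCurve_near {f : Euc N → Euc N} (hf : ContDiff ℝ 1 f) (x : Euc N) {η : ℝ}
    (hη : 0 < η) : ∃ ρ > 0, ∀ z, ‖z - x‖ ≤ ρ → ∃ γ : ℝ → Euc N, γ 0 = z ∧
      ∀ s ∈ Icc (-ρ) 0, HasDerivAt γ (f (γ s)) s ∧ ‖f (γ s) - f x‖ ≤ η := by
  obtain ⟨ε, hε, a, r, L, K, hr, hpl⟩ := IsPicardLindelof.of_contDiffAt_one (hf.contDiffAt (x := x))
  obtain ⟨α, hα, hαc⟩ := (hpl 0).exists_forall_mem_closedBall_eq_hasDerivWithinAt_continuousOn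
  have hr' : (0 : ℝ) < r := hr
  have hx : α (x, 0) = x := (hα x (by simp)).1
  -- Joint continuity of the local flow in point and time gives the uniformity in the starting
  -- point.
  have hcont : ContinuousAt α (x, 0) :=
    hαc.continuousAt (prod_mem_nhds (Metric.closedBall_mem_nhds x hr')
      (Icc_mem_nhds (by linarith) (by linarith)))
  have hfc : Tendsto (fun w => f (α w)) (𝓝 (x, 0)) (𝓝 (f x)) := by
    have := hf.continuous.continuousAt.comp hcont
    rw [ContinuousAt, Function.comp_apply, hx] at this
    exact this
  obtain ⟨d, hd, hball⟩ := Metric.eventually_nhds_iff_ball.1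
    (hfc.eventually (Metric.closedBall_mem_nhds (f x) hη))
  refine ⟨min r (min (ε / 2) (d / 2)), by positivity, fun z hz => ?_⟩
  simp only [le_min_iff] at hz
  have hzb := hα z (by rw [mem_closedBall_iff_norm]; exact hz.1)
  refine ⟨fun s => α (z, s), hzb.1, fun s hs => ⟨?_, ?_⟩⟩
  · have h1 : -(ε / 2) ≤ s :=
      (neg_le_neg ((min_le_right _ _).trans (min_le_left _ _))).trans hs.1
    exact (hzb.2 s ⟨by linarith, by linarith [hs.2]⟩).hasDerivAt
      (Icc_mem_nhds (by linarith) (by linarith [hs.2]))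
  · have h1 : -(d / 2) ≤ s :=
      (neg_le_neg ((min_le_right _ _).trans (min_le_right _ _))).trans hs.1
    have := hball (z, s) (by
      rw [mem_ball_iff_norm, Prod.mk_sub_mk, Prod.norm_def]
      refine max_lt (by dsimp only; linarith [hz.2.2]) ?_
      dsimp only
      rw [sub_zero, Real.norm_eq_abs, abs_lt]
      exact ⟨by linarith, by linarith [hs.2]⟩)
    rwa [dist_eq_norm] at this

namespace IsTonelli

variable {H : Torus N → Euc N → ℝ} (hH : IsTonelli H)
include hH

/-- The curves with velocity `D_p H(·, p)` have an action of the expected size. -/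
lemma exists_curve_integral_lagrangianAlong_le (x p : Euc N) {η : ℝ} (hη : 0 < η) : ∃ ρ > 0,
    ∀ z, ‖z - x‖ ≤ ρ → ∀ t, 0 < t → t ≤ ρ → ∃ γ : ℝ → Euc N,
      AbsolutelyContinuousOnInterval γ (-t) 0 ∧ γ 0 = z ∧
      IntervalIntegrable (lagrangianAlong H γ) volume (-t) 0 ∧
      ‖γ (-t) - (z - t • gradP H (proj x) p)‖ ≤ η * t ∧
      ∫ s in (-t)..0, lagrangianAlong H γ s ≤ inner ℝ p (z - γ (-t)) - t * H (proj x) p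
        - t * inner ℝ (gradX H (proj x) p) (z - x)
        + t ^ 2 / 2 * inner ℝ (gradX H (proj x) p) (gradP H (proj x) p)
        + η * (‖z - x‖ + (‖gradP H (proj x) p‖ + η) * t) * t
        + ‖gradX H (proj x) p‖ * η * t ^ 2 := by
  set D := gradX H (proj x) p with hD
  set V := gradP H (proj x) p with hV
  obtain ⟨δ, hδ0, hδ⟩ := hH.exists_taylor x p hη
  obtain ⟨ρ, hρ0, hρ⟩ := exists_integralCurve_near (hH.contDiff_gradP p) x hη
  have hk : 0 < 1 + ‖V‖ + η := by positivity
  refine ⟨min ρ (δ / (1 + ‖V‖ + η)), by positivity, fun z hz t ht htρ => ?_⟩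
  obtain ⟨γ, hγ0, hγ⟩ := hρ z (hz.trans (min_le_left _ _))
  have htρ' : t ≤ ρ := htρ.trans (min_le_left _ _)
  have hsub : Icc (-t) 0 ⊆ Icc (-ρ) 0 := Icc_subset_Icc_left (by linarith)
  have h0 : (0 : ℝ) ∈ Icc (-t) 0 := ⟨by linarith, le_rfl⟩
  have ht0 : -t ∈ Icc (-t) 0 := ⟨le_rfl, by linarith⟩
  have hcurve : ∀ s ∈ Icc (-t) 0, ‖γ s - z - s • V‖ ≤ η * t := by
    intro s hs
    have := (convex_Icc (-t) 0).norm_image_sub_le_of_norm_hasDerivWithin_le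
      (f := fun s => γ s - s • V) (f' := fun s => gradP H (proj (γ s)) p - V) (C := η)
      (fun r hr => by
        have := (hγ r (hsub hr)).1.sub ((hasDerivAt_id r).smul_const V)
        rw [one_smul] at this
        exact this.hasDerivWithinAt) (fun r hr => (hγ r (hsub hr)).2) h0 hs
    simp only [hγ0, zero_smul, sub_zero, Real.norm_eq_abs] at this
    rw [sub_right_comm]
    refine this.trans ?_
    gcongr
    rw [abs_of_nonpos hs.2]
    linarith [hs.1]
  set R := ‖z - x‖ + (‖V‖ + η) * t with hR
  have hRδ : R ≤ δ := by
    have h1 := hz.trans (min_le_right _ _)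
    have h2 := htρ.trans (min_le_right _ _)
    have h3 : (‖V‖ + η) * t ≤ (‖V‖ + η) * (δ / (1 + ‖V‖ + η)) := by gcongr
    have h4 : δ / (1 + ‖V‖ + η) + (‖V‖ + η) * (δ / (1 + ‖V‖ + η)) = δ := by field_simp; ring
    linarith
  have hγR : ∀ s ∈ Icc (-t) 0, ‖γ s - x‖ ≤ R := by
    intro s hs
    have h1 : γ s - x = (γ s - z - s • V) + (z - x) + s • V := by abel
    have h2 : ‖s • V‖ ≤ t * ‖V‖ := by
      rw [norm_smul, Real.norm_eq_abs, abs_of_nonpos hs.2]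
      gcongr
      linarith [hs.1]
    rw [h1]
    refine (norm_add₃_le).trans ?_
    linarith [hcurve s hs]
  have hcont : ContinuousOn γ (uIcc (-t) 0) := by
    rw [uIcc_of_le (by linarith)]
    exact fun s hs => (hγ s (hsub hs)).1.continuousAt.continuousWithinAt
  -- Along this curve Fenchel is an equality with the fixed momentum `p`, so only the dependence of
  -- `H (·, p)` on position needs expanding.
  have hLeq : ∀ s ∈ Icc (-t) 0, lagrangianAlong H γ s =
      inner ℝ p (gradP H (proj (γ s)) p) - H (proj (γ s)) p := by
    intro s hs
    rw [lagrangianAlong, (hγ s (hsub hs)).1.deriv, hH.lagrangian_gradP]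
  have hcH : Continuous fun y : Euc N => H (proj y) p :=
    hH.continuous.comp (continuous_proj.prodMk continuous_const)
  have hint : IntervalIntegrable (lagrangianAlong H γ) volume (-t) 0 := by
    refine ContinuousOn.intervalIntegrable ?_
    have h1 : ContinuousOn (fun s => inner ℝ p (gradP H (proj (γ s)) p) - H (proj (γ s)) p)
        (uIcc (-t) 0) :=
      (continuousOn_const.inner (𝕜 := ℝ)
        ((hH.contDiff_gradP p).continuous.comp_continuousOn hcont)).sub (hcH.comp_continuousOn hcont)
    refine h1.congr fun s hs => hLeq s ?_
    rwa [uIcc_of_le (by linarith)] at hs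
  have hac : AbsolutelyContinuousOnInterval γ (-t) 0 := by
    refine LipschitzOnWith.absolutelyContinuousOnInterval (K := ‖V‖₊ + η.toNNReal) ?_
    rw [uIcc_of_le (by linarith)]
    refine (convex_Icc (-t) 0).lipschitzOnWith_of_nnnorm_hasDerivWithin_le
      (fun s hs => (hγ s (hsub hs)).1.hasDerivWithinAt) fun s hs => ?_
    have h1 : ‖gradP H (proj (γ s)) p‖ ≤ ‖V‖ + ‖gradP H (proj (γ s)) p - V‖ :=
      norm_le_insert' _ _
    have h2 := (hγ s (hsub hs)).2
    rw [← NNReal.coe_le_coe, NNReal.coe_add, Real.coe_toNNReal _ hη.le, coe_nnnorm, coe_nnnorm]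
    linarith
  refine ⟨γ, hac, hγ0, hint, ?_, ?_⟩
  · have := hcurve (-t) ht0
    rwa [neg_smul, sub_neg_eq_add, sub_add] at this
  -- The integrated inequality is applied to `-L` and `-⟨p, γ⟩`, which turns a lower bound into an
  -- upper one.
  · have key := sub_add_integral_le_of_deriv_add_le (by linarith : -t ≤ 0)
      (AbsolutelyContinuousOnInterval.inner_left hac (-p)) hint.neg
      (c := fun s => H (proj x) p + inner ℝ D (z - x) - ‖D‖ * (η * t) - η * R + s * inner ℝ D V)
      (by fun_prop) (Eventually.of_forall fun s hs => by
        have h1 : HasDerivAt (fun s => inner ℝ (-p) (γ s))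
            (inner ℝ (-p) (gradP H (proj (γ s)) p)) s := by
          simpa using (hasDerivAt_const s (-p)).inner ℝ (hγ s (hsub hs)).1
        rw [h1.deriv, Pi.neg_apply, hLeq s hs, inner_neg_left]
        have h2 := (abs_le.1 (hδ (γ s) p ((hγR s hs).trans hRδ) (by simpa using hδ0.le))).1
        rw [sub_self, inner_zero_right, norm_zero, add_zero] at h2
        have h3 : η * ‖γ s - x‖ ≤ η * R := by
          gcongr
          exact hγR s hs
        have h4 := (abs_le.1 (abs_real_inner_le_norm D (γ s - z - s • V))).1
        have h5 : ‖D‖ * ‖γ s - z - s • V‖ ≤ ‖D‖ * (η * t) := by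
          gcongr
          exact hcurve s hs
        have h6 : γ s - x = (γ s - z - s • V) + (z - x) + s • V := by abel
        rw [← hD, h6, inner_add_right, inner_add_right, real_inner_smul_right, ← h6] at h2
        linarith)
    have hI : ∫ s in (-t)..0,
        (H (proj x) p + inner ℝ D (z - x) - ‖D‖ * (η * t) - η * R + s * inner ℝ D V)
        = t * (H (proj x) p + inner ℝ D (z - x) - ‖D‖ * (η * t) - η * R)
          - t ^ 2 / 2 * inner ℝ D V := by
      rw [intervalIntegral.integral_add (by simp) (Continuous.intervalIntegrable (by fun_prop) _ _),
        intervalIntegral.integral_mul_const, intervalIntegral.integral_const]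
      simp
      ring
    have hneg : ∫ s in (-t)..0, (-lagrangianAlong H γ) s =
        -∫ s in (-t)..0, lagrangianAlong H γ s := intervalIntegral.integral_neg
    rw [hI, hneg, ← inner_sub_right, inner_neg_left, hγ0] at key
    linarith

end IsTonelli

lemma laxOleinik_le {H : Torus N → Euc N → ℝ} {t : ℝ} {u : Torus N → EReal} {x : Torus N}
    {γ : ℝ → Euc N} (hγ : AbsolutelyContinuousOnInterval γ (-t) 0) (hx : proj (γ 0) = x) :
    laxOleinik H t u x ≤ u (proj (γ (-t))) + action H t γ :=
  iInf_le_of_le γ (iInf₂_le hγ hx)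

/-- Second order upper bound for `S_H(ε) S_G(ε) u` at `x`, for the affine datum `u`. -/
theorem exists_laxOleinik_laxOleinik_le {G H : Torus N → Euc N → ℝ} (hG : IsTonelli G)
    (hH : IsTonelli H) (x p : Euc N) : ∃ K : ℝ, ∀ η, 0 < η → η ≤ 1 → ∃ ε₀ > 0, ∀ ε, 0 < ε → ε ≤ ε₀ →
    laxOleinik H ε (laxOleinik G ε (affineDatum x p)) (proj x) ≤
    ((-ε * (H (proj x) p + G (proj x) p)
      + ε ^ 2 / 2 * (inner ℝ (gradX H (proj x) p) (gradP H (proj x) p)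
        + inner ℝ (gradX G (proj x) p) (gradP G (proj x) p))
      + ε ^ 2 * inner ℝ (gradX G (proj x) p) (gradP H (proj x) p) + K * η * ε ^ 2 : ℝ) : EReal) := by
  set DH := gradX H (proj x) p with hDH
  set DG := gradX G (proj x) p with hDG
  set VH := gradP H (proj x) p with hVH
  set VG := gradP G (proj x) p with hVG
  refine ⟨2 * (‖VH‖ + 1) + (‖VG‖ + 1) + ‖DH‖ + 2 * ‖DG‖, fun η hη hη1 => ?_⟩
  obtain ⟨ρ₁, hρ₁0, hρ₁⟩ := hH.exists_curve_integral_lagrangianAlong_le x p hη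
  obtain ⟨ρ₂, hρ₂0, hρ₂⟩ := hG.exists_curve_integral_lagrangianAlong_le x p hη
  set κ := ‖VH‖ + ‖VG‖ + 2 with hκ
  have hκ0 : 0 < κ := by positivity
  -- `ρ₂ / κ` keeps the starting point of the second test curve in range. `1 / 2 / κ` keeps the
  -- final point in the ball where the datum is affine.
  refine ⟨min (min ρ₁ ρ₂) (min (ρ₂ / κ) (1 / 2 / κ)), by positivity, fun ε hε0 hε => ?_⟩
  simp only [le_min_iff, le_div_iff₀ hκ0] at hε
  obtain ⟨⟨hε1, hε2⟩, hε3, hε4⟩ := hε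
  obtain ⟨γ₁, hac₁, hγ₁0, hi₁, he₁, hb₁⟩ := hρ₁ x (by simpa using hρ₁0.le) ε hε0 hε1
  have hz : ‖γ₁ (-ε) - x‖ ≤ (‖VH‖ + 1) * ε := by
    have h1 : γ₁ (-ε) - x = (γ₁ (-ε) - (x - ε • VH)) - ε • VH := by abel
    rw [h1]
    refine (norm_sub_le _ _).trans ?_
    rw [norm_smul, Real.norm_of_nonneg hε0.le]
    have : η * ε ≤ 1 * ε := by gcongr
    linarith
  obtain ⟨γ₂, hac₂, hγ₂0, hi₂, he₂, hb₂⟩ := hρ₂ (γ₁ (-ε)) (hz.trans (by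
    refine le_trans ?_ hε3
    rw [mul_comm]
    gcongr
    rw [hκ]
    linarith [norm_nonneg VG])) ε hε0 hε2
  have hv : ‖γ₂ (-ε) - x‖ ≤ 1 / 2 := by
    have h1 : γ₂ (-ε) - x =
        (γ₂ (-ε) - (γ₁ (-ε) - ε • VG)) - ε • VG + (γ₁ (-ε) - x) := by abel
    rw [h1]
    refine (norm_add_le _ _).trans ?_
    have h2 := norm_sub_le (γ₂ (-ε) - (γ₁ (-ε) - ε • VG)) (ε • VG)
    rw [norm_smul, Real.norm_of_nonneg hε0.le] at h2
    have : η * ε ≤ 1 * ε := by gcongr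
    rw [hκ] at hε4
    linarith
  have hu : affineDatum x p (proj (γ₂ (-ε))) ≤ ((inner ℝ p (γ₂ (-ε) - x) : ℝ) : EReal) :=
    iInf₂_le _ ⟨hv, by rw [add_sub_cancel]⟩
  have hS₂ : laxOleinik G ε (affineDatum x p) (proj (γ₁ (-ε))) ≤
      ((inner ℝ p (γ₂ (-ε) - x) + ∫ s in (-ε)..0, lagrangianAlong G γ₂ s : ℝ) : EReal) := by
    refine (laxOleinik_le hac₂ (by rw [hγ₂0])).trans ?_
    rw [action_eq_coe hi₂, EReal.coe_add]
    exact add_le_add_left hu _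
  refine (laxOleinik_le hac₁ (by rw [hγ₁0])).trans ?_
  rw [action_eq_coe hi₁]
  refine (add_le_add_left hS₂ _).trans ?_
  rw [← EReal.coe_add, EReal.coe_le_coe_iff]
  rw [← hDH, ← hVH, sub_self, inner_zero_right, norm_zero, zero_add] at hb₁
  rw [← hDG, ← hVG] at hb₂
  -- Source of the cross term: the `G` stage is based near `x - ε • VH` instead of `x`.
  have h1 : -(ε * inner ℝ DG VH) - ‖DG‖ * (η * ε) ≤ inner ℝ DG (γ₁ (-ε) - x) := by
    have a1 : γ₁ (-ε) - x = (γ₁ (-ε) - (x - ε • VH)) - ε • VH := by abel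
    have a2 := (abs_le.1 (abs_real_inner_le_norm DG (γ₁ (-ε) - (x - ε • VH)))).1
    have a3 : ‖DG‖ * ‖γ₁ (-ε) - (x - ε • VH)‖ ≤ ‖DG‖ * (η * ε) := by gcongr
    rw [a1, inner_sub_right, real_inner_smul_right]
    linarith
  have h2 := mul_le_mul_of_nonneg_left h1 hε0.le
  have h3 : η * ((‖VH‖ + η) * ε) * ε ≤ η * ((‖VH‖ + 1) * ε) * ε := by gcongr
  have h4 : η * (‖γ₁ (-ε) - x‖ + (‖VG‖ + η) * ε) * ε ≤
      η * ((‖VH‖ + 1) * ε + (‖VG‖ + 1) * ε) * ε := by gcongr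
  have h5 : inner ℝ p (γ₂ (-ε) - x) + inner ℝ p (γ₁ (-ε) - γ₂ (-ε)) + inner ℝ p (x - γ₁ (-ε))
      = 0 := by
    rw [← inner_add_right, ← inner_add_right]
    simp
  linarith

/-! ### Comparison of the two expansions. -/

theorem inner_gradX_gradP_le_of_commute {G H : Torus N → Euc N → ℝ} (hG : IsTonelli G)
    (hH : IsTonelli H)
    (hcomm : ∀ u : Torus N → EReal, IsAdmissible u → ∀ s t : ℝ, 0 < s → 0 < t → ∀ x : Torus N,
      laxOleinik G s (laxOleinik H t u) x = laxOleinik H t (laxOleinik G s u) x)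
    (x : Torus N) (p : Euc N) :
    inner ℝ (gradX H x p) (gradP G x p) ≤ inner ℝ (gradX G x p) (gradP H x p) := by
  obtain ⟨x, rfl⟩ := proj_surjective x
  obtain ⟨K₁, hK₁⟩ := exists_le_laxOleinik_laxOleinik hG hH x p
  obtain ⟨K₂, hK₂⟩ := exists_laxOleinik_laxOleinik_le hG hH x p
  have key : ∀ η, 0 < η → η ≤ 1 → inner ℝ (gradX H (proj x) p) (gradP G (proj x) p) ≤
      inner ℝ (gradX G (proj x) p) (gradP H (proj x) p) + (K₁ + K₂) * η := by
    intro η hη hη1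
    obtain ⟨ε₁, hε₁, h₁⟩ := hK₁ η hη
    obtain ⟨ε₂, hε₂, h₂⟩ := hK₂ η hη hη1
    have hε : 0 < min ε₁ ε₂ := lt_min hε₁ hε₂
    have h := (h₁ _ hε (min_le_left _ _)).trans ((hcomm _ (isAdmissible_affineDatum x p) _ _ hε hε
      _).le.trans (h₂ _ hε (min_le_right _ _)))
    rw [EReal.coe_le_coe_iff] at h
    -- The first-order and symmetric second-order terms agree on both sides, so only multiples of
    -- `ε²` remain.
    refine le_of_mul_le_mul_left ?_ (pow_pos hε 2)
    linarith
  have hlim : Tendsto (fun η : ℝ => inner ℝ (gradX G (proj x) p) (gradP H (proj x) p)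
      + (K₁ + K₂) * η) (𝓝[>] 0) (𝓝 (inner ℝ (gradX G (proj x) p) (gradP H (proj x) p))) := by
    refine tendsto_nhdsWithin_of_tendsto_nhds (Continuous.tendsto' (by fun_prop) _ _ (by simp))
  refine ge_of_tendsto hlim ?_
  filter_upwards [Ioc_mem_nhdsGT one_pos] with η hη using key η hη.1 hη.2

end HamiltonJacobi

end

theorem mainTheorem7 (N : ℕ) (G H : HamiltonJacobi.Torus N → HamiltonJacobi.Euc N → ℝ)
    (hG : HamiltonJacobi.IsTonelli G) (hH : HamiltonJacobi.IsTonelli H)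
    (hcomm : ∀ u : HamiltonJacobi.Torus N → EReal, HamiltonJacobi.IsAdmissible u →
      ∀ s t : ℝ, 0 < s → 0 < t → ∀ x : HamiltonJacobi.Torus N,
        HamiltonJacobi.laxOleinik G s (HamiltonJacobi.laxOleinik H t u) x =
          HamiltonJacobi.laxOleinik H t (HamiltonJacobi.laxOleinik G s u) x) :
    ∀ (x : HamiltonJacobi.Torus N) (p : HamiltonJacobi.Euc N),
      inner ℝ (HamiltonJacobi.gradX G x p) (HamiltonJacobi.gradP H x p) -
        inner ℝ (HamiltonJacobi.gradX H x p) (HamiltonJacobi.gradP G x p) = 0 := by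
  intro x p
  have h1 := HamiltonJacobi.inner_gradX_gradP_le_of_commute hG hH hcomm x p
  have h2 := HamiltonJacobi.inner_gradX_gradP_le_of_commute hH hG
    (fun u hu s t hs ht x => (hcomm u hu t s ht hs x).symm) x p
  linarith
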